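/- **Proposition 1 (Additivity of linear uncertainty relations).** Let $\mathcal H_A,\mathcal H_B$ be finite-dimensional complex Hilbert spaces. A *state* is a positive semidefinite operator of trace one; a *projective measurement* is a finite family $X=\{X_i\}$ of mutually orthogonal projections with $\sum_i X_i=\mathbb 1$; and $H(X|\rho)=-\sum_i p_i\log p_i$ with $p_i=\operatorname{tr}(\rho X_i)$ and $0\log 0=0$ is the Shannon entropy (natural logarithm) of its outcome distribution in the state $\rho$. Let $X_A,Y_A$ be projective measurements on $\mathcal H_A$, let $X_B,Y_B$ be projective measurements on $\mathcal H_B$, and let $X_{AB}=\{X_{A,i}\otimes X_{B,j}\}_{i,j}$ and $Y_{AB}=\{Y_{A,k}\otimes Y_{B,l}\}_{k,l}$ be the joint measurements on $\mathcal H_A\otimes\mathcal H_B$. Fix weights $\lambda,\mu\ge 0$. 1. Suppose that the real numbers $c_A=c_A(\lambda,\mu)$ and $c_B=c_B(\lambda,\mu)$ satisfy $$\lambda H(X_A|\rho_A)+\mu H(Y_A|\rho_A)\ge c_A,\qquad \lambda H(X_B|\rho_B)+\mu H(Y_B|\rho_B)\ge c_B$$ for all states $\rho_A$ on $\mathcal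 H_A$ and $\rho_B$ on $\mathcal H_B$. Then $$\lambda H(X_{AB}|\rho_{AB})+\mu H(Y_{AB}|\rho_{AB})\ge c_A+c_B$$ for every state $\rho_{AB}$ on $\mathcal H_A\otimes\mathcal H_B$, entangled or not. 2. If $c_A$ and $c_B$ are optimal, i.e. each is the largest constant for which its inequality holds on all states, then $c_{AB}:=c_A+c_B$ is the largest constant for which $$\lambda H(X_{AB}|\rho_{AB})+\mu H(Y_{AB}|\rho_{AB})\ge c_{AB}$$ holds for all states $\rho_{AB}$, and equality is attained at some product state $\rho_A\otimes\rho_B$. -/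

import Mathlib

open scoped Kronecker ComplexOrder

/-- A quantum state on the finite-dimensional Hilbert space `ℂⁿ`: a positive semidefinite matrix
of trace one. -/
structure IsQuantumState {n : Type*} [Fintype n] (ρ : Matrix n n ℂ) : Prop where
  posSemidef : ρ.PosSemidef
  trace_eq_one : ρ.trace = 1

/-- A projective measurement with outcomes in `ι`: mutually orthogonal Hermitian projections that
sum to the identity. The projections may have any rank. -/
structure IsProjectiveMeasurement {ι n : Type*} [Fintype ι] [Fintype n] [DecidableEq n]
    (X : ι → Matrix n n ℂ) : Prop where
  isHermitian : ∀ i, (X i).IsHermitian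
  mul_self : ∀ i, X i * X i = X i
  orthogonal : ∀ i j, i ≠ j → X i * X j = 0
  sum_eq_one : ∑ i, X i = 1

/-- The joint measurement that arises from performing `X` on the first and `X'` on the second
subsystem; the outcomes are all pairs of local outcomes. -/
def productMeasurement {ι κ n m : Type*} (X : ι → Matrix n n ℂ) (X' : κ → Matrix m m ℂ) :
    ι × κ → Matrix (n × m) (n × m) ℂ :=
  fun k => X k.1 ⊗ₖ X' k.2

/-- The probability `tr (ρ Xᵢ)` of outcome `i` (a real number whenever `ρ` is a state and `X` is a
projective measurement). -/
noncomputable def outcomeProb {ι n : Type*} [Fintype n] (X : ι → Matrix n n ℂ)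
    (ρ : Matrix n n ℂ) (i : ι) : ℝ :=
  (ρ * X i).trace.re

/-- The Shannon entropy `H(X|ρ) = - ∑ᵢ pᵢ log pᵢ`, with the convention `0 log 0 = 0`. -/
noncomputable def measurementEntropy {ι n : Type*} [Fintype ι] [Fintype n]
    (X : ι → Matrix n n ℂ) (ρ : Matrix n n ℂ) : ℝ :=
  ∑ i, Real.negMulLog (outcomeProb X ρ i)

/-- The weighted entropy sum `lam * H(X|ρ) + mu * H(Y|ρ)`. -/
noncomputable def linearUncertainty {ι κ n : Type*} [Fintype ι] [Fintype κ] [Fintype n]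
    (lam mu : ℝ) (X : ι → Matrix n n ℂ) (Y : κ → Matrix n n ℂ) (ρ : Matrix n n ℂ) : ℝ :=
  lam * measurementEntropy X ρ + mu * measurementEntropy Y ρ

/-- `c` is a state-independent lower bound on the weighted entropy sum. -/
def IsUncertaintyBound {ι κ n : Type*} [Fintype ι] [Fintype κ] [Fintype n]
    (lam mu : ℝ) (X : ι → Matrix n n ℂ) (Y : κ → Matrix n n ℂ) (c : ℝ) : Prop :=
  ∀ ρ : Matrix n n ℂ, IsQuantumState ρ → c ≤ linearUncertainty lam mu X Y ρ

/-- `c` is the optimal, i.e. the largest, state-independent lower bound. -/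
def IsOptimalUncertaintyBound {ι κ n : Type*} [Fintype ι] [Fintype κ] [Fintype n]
    (lam mu : ℝ) (X : ι → Matrix n n ℂ) (Y : κ → Matrix n n ℂ) (c : ℝ) : Prop :=
  IsGreatest {c' : ℝ | IsUncertaintyBound lam mu X Y c'} c

/-!
Entropies conditioned on an outcome of the other subsystem split the joint problem. Given the
outcome of `XB` on the second subsystem, the first one is in a genuine quantum state, so the bound
`cA` holds conditionally: `cA ≤ lam H(XA|XB) + mu H(YA|XB)`. In the same way, conditioning on the
outcome of `YA` gives `cB ≤ lam H(XB|YA) + mu H(YB|YA)`. When these are added, the chain rule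
`H(X|Z) = H(XZ) - H(Z)` turns the right-hand side into
`lam H(XA XB) + mu H(YA YB) + (lam + mu) (H(YA XB) - H(YA) - H(XB))`, and the last bracket is
nonpositive by subadditivity. This works for arbitrary POVMs. Since the set of states is compact,
optimal bounds are attained, and entropies of joint measurements add up in product states.
-/

section Entropy

open Real

theorem negMulLog_le_neg_mul_log_add_sub {p q : ℝ} (hp : 0 ≤ p) (hq : 0 ≤ q)
    (hpq : q = 0 → p = 0) : negMulLog p ≤ -(p * log q) + (q - p) := by
  rcases hp.eq_or_lt with rfl | hp
  · simpa using hq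
  have hq : 0 < q := hq.lt_of_ne' fun h => hp.ne' (hpq h)
  have hlog : log q - log p ≤ q / p - 1 := by
    rw [← log_div hq.ne' hp.ne']
    exact log_le_sub_one_of_pos (div_pos hq hp)
  calc negMulLog p = -(p * log q) + p * (log q - log p) := by rw [negMulLog]; ring
    _ ≤ -(p * log q) + p * (q / p - 1) := by gcongr
    _ = -(p * log q) + (q - p) := by rw [mul_sub, mul_div_cancel₀ _ hp.ne', mul_one]

theorem sum_negMulLog_le_neg_sum_mul_log {ι : Type*} {s : Finset ι} {p q : ι → ℝ}
    (hp : ∀ i ∈ s, 0 ≤ p i) (hq : ∀ i ∈ s, 0 ≤ q i) (hpq : ∀ i ∈ s, q i = 0 → p i = 0)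
    (hsum : ∑ i ∈ s, q i ≤ ∑ i ∈ s, p i) :
    ∑ i ∈ s, negMulLog (p i) ≤ -∑ i ∈ s, p i * log (q i) := by
  have h := Finset.sum_le_sum fun i hi =>
    negMulLog_le_neg_mul_log_add_sub (hp i hi) (hq i hi) (hpq i hi)
  rw [Finset.sum_add_distrib, Finset.sum_sub_distrib, Finset.sum_neg_distrib] at h
  linarith

theorem sum_negMulLog_le_sum_marginals {ι κ : Type*} [Fintype ι] [Fintype κ] {w : ι × κ → ℝ}
    (hw : ∀ k, 0 ≤ w k) (hsum : ∑ k, w k ≤ 1) :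
    ∑ k, negMulLog (w k) ≤
      ∑ i, negMulLog (∑ j, w (i, j)) + ∑ j, negMulLog (∑ i, w (i, j)) := by
  set r : ι → ℝ := fun i => ∑ j, w (i, j)
  set s : κ → ℝ := fun j => ∑ i, w (i, j)
  have hwr (k) : w k ≤ r k.1 :=
    Finset.single_le_sum (f := fun j => w (k.1, j)) (fun j _ => hw _) (Finset.mem_univ k.2)
  have hws (k) : w k ≤ s k.2 :=
    Finset.single_le_sum (f := fun i => w (i, k.2)) (fun i _ => hw _) (Finset.mem_univ k.1)
  have hr (k : ι × κ) : 0 ≤ r k.1 := (hw k).trans (hwr k)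
  have hs (k : ι × κ) : 0 ≤ s k.2 := (hw k).trans (hws k)
  have hsum_r : ∑ i, r i = ∑ k, w k := (Fintype.sum_prod_type w).symm
  have hsum_s : ∑ j, s j = ∑ k, w k := (Fintype.sum_prod_type_right w).symm
  have hsum_rs : ∑ k : ι × κ, r k.1 * s k.2 ≤ ∑ k, w k := by
    rw [Fintype.sum_prod_type, ← Finset.sum_mul_sum, hsum_r, hsum_s]
    exact mul_le_of_le_one_left (Finset.sum_nonneg fun k _ => hw k) hsum
  have hrs_zero (k : ι × κ) (h : r k.1 * s k.2 = 0) : w k = 0 := by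
    rcases mul_eq_zero.1 h with h | h
    · exact le_antisymm (h ▸ hwr k) (hw k)
    · exact le_antisymm (h ▸ hws k) (hw k)
  have hlog (k : ι × κ) :
      w k * log (r k.1 * s k.2) = w k * log (r k.1) + w k * log (s k.2) := by
    rcases (hw k).eq_or_lt with h | h
    · simp [← h]
    · rw [log_mul (h.trans_le (hwr k)).ne' (h.trans_le (hws k)).ne', mul_add]
  calc ∑ k, negMulLog (w k) ≤ -∑ k : ι × κ, w k * log (r k.1 * s k.2) :=
        sum_negMulLog_le_neg_sum_mul_log (fun k _ => hw k)
          (fun k _ => mul_nonneg (hr k) (hs k)) (fun k _ => hrs_zero k) hsum_rs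
    _ = ∑ i, negMulLog (r i) + ∑ j, negMulLog (s j) := by
        simp only [hlog, Finset.sum_add_distrib]
        rw [Fintype.sum_prod_type, Fintype.sum_prod_type_right]
        simp only [negMulLog, neg_mul, ← Finset.sum_mul, Finset.sum_neg_distrib, neg_add, r, s]

end Entropy

section Matrix

open Matrix

theorem sum_kronecker {R l m n p ι : Type*} [NonUnitalNonAssocSemiring R] (s : Finset ι)
    (A : ι → Matrix l m R) (B : Matrix n p R) : (∑ i ∈ s, A i) ⊗ₖ B = ∑ i ∈ s, A i ⊗ₖ B := by
  ext
  simp [Matrix.sum_apply, Finset.sum_mul]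

theorem kronecker_sum {R l m n p ι : Type*} [NonUnitalNonAssocSemiring R] (s : Finset ι)
    (A : Matrix l m R) (B : ι → Matrix n p R) : A ⊗ₖ (∑ i ∈ s, B i) = ∑ i ∈ s, A ⊗ₖ B i := by
  ext
  simp [Matrix.sum_apply, Finset.mul_sum]

theorem trace_submatrix_equiv {R m n : Type*} [AddCommMonoid R] [Fintype m] [Fintype n]
    (A : Matrix n n R) (e : m ≃ n) : (A.submatrix e e).trace = A.trace :=
  e.sum_comp fun i => A i i

theorem trace_submatrix_prodComm_mul_kronecker {R m n : Type*} [CommSemiring R] [Fintype m]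
    [Fintype n] (A : Matrix (m × n) (m × n) R) (M : Matrix m m R) (N : Matrix n n R) :
    (A.submatrix (Equiv.prodComm n m) (Equiv.prodComm n m) * N ⊗ₖ M).trace =
      (A * M ⊗ₖ N).trace := by
  have hswap : N ⊗ₖ M = (M ⊗ₖ N).submatrix (Equiv.prodComm n m) (Equiv.prodComm n m) := by
    ext
    simp [mul_comm]
  rw [hswap, submatrix_mul_equiv, trace_submatrix_equiv]

variable {𝕜 n : Type*} [RCLike 𝕜]

theorem trace_mul_nonneg_of_posSemidef [Fintype n] {A B : Matrix n n 𝕜} (hA : A.PosSemidef)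
    (hB : B.PosSemidef) : 0 ≤ (A * B).trace := by
  obtain ⟨_, v, rfl⟩ := posSemidef_iff_eq_sum_vecMulVec.1 hB
  simp only [Finset.mul_sum, trace_sum, mul_vecMulVec, trace_vecMulVec, dotProduct_comm (A *ᵥ _)]
  exact Finset.sum_nonneg fun i _ => hA.dotProduct_mulVec_nonneg (v i)

theorem norm_sq_apply_le_of_posSemidef {A : Matrix n n 𝕜} (hA : A.PosSemidef) (i j : n) :
    ‖A i j‖ ^ 2 ≤ RCLike.re (A i i) * RCLike.re (A j j) := by
  have hdet := (RCLike.le_iff_re_im.1 (hA.submatrix ![i, j]).det_nonneg).1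
  have him (k) : RCLike.im (A k k) = 0 := by
    simpa using (RCLike.le_iff_re_im.1 (hA.diag_nonneg (i := k))).2.symm
  have hconj : A i j * A j i = (‖A i j‖ ^ 2 : ℝ) := by
    rw [← hA.isHermitian.apply j i, RCLike.star_def, RCLike.mul_conj]
    norm_cast
  rw [det_fin_two] at hdet
  simpa [him, hconj] using hdet

theorem isClosed_setOf_posSemidef [Finite n] : IsClosed {A : Matrix n n 𝕜 | A.PosSemidef} := by
  have := Fintype.ofFinite n
  simp only [posSemidef_iff_dotProduct_mulVec, Set.ofPred_and, Set.ofPred_forall]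
  refine (isClosed_eq (by fun_prop) continuous_id).inter (isClosed_iInter fun x => ?_)
  exact isClosed_le continuous_const (by fun_prop)

end Matrix

section QuantumState

variable {n m : Type*} [Fintype n] [Fintype m]

theorem IsQuantumState.submatrix_equiv {ρ : Matrix n n ℂ} (hρ : IsQuantumState ρ) (e : m ≃ n) :
    IsQuantumState (ρ.submatrix e e) :=
  ⟨hρ.posSemidef.submatrix e, by rw [trace_submatrix_equiv, hρ.trace_eq_one]⟩

theorem IsQuantumState.kronecker {ρ : Matrix n n ℂ} {σ : Matrix m m ℂ} (hρ : IsQuantumState ρ)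
    (hσ : IsQuantumState σ) : IsQuantumState (ρ ⊗ₖ σ) :=
  ⟨hρ.posSemidef.kronecker hσ.posSemidef,
    by rw [Matrix.trace_kronecker, hρ.trace_eq_one, hσ.trace_eq_one, one_mul]⟩

theorem IsQuantumState.norm_apply_le_one {ρ : Matrix n n ℂ} (hρ : IsQuantumState ρ) (i j : n) :
    ‖ρ i j‖ ≤ 1 := by
  have hdiag_nonneg (k) : 0 ≤ (ρ k k).re := (Complex.le_def.1 hρ.posSemidef.diag_nonneg).1
  have hdiag_le (k) : (ρ k k).re ≤ 1 := by
    calc (ρ k k).re ≤ ∑ l, (ρ l l).re :=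
          Finset.single_le_sum (fun l _ => hdiag_nonneg l) (Finset.mem_univ k)
      _ = ρ.trace.re := (Complex.re_sum _ _).symm
      _ = 1 := by rw [hρ.trace_eq_one, Complex.one_re]
  rw [← sq_le_one_iff₀ (norm_nonneg _)]
  exact (norm_sq_apply_le_of_posSemidef hρ.posSemidef i j).trans
    (mul_le_one₀ (hdiag_le i) (hdiag_nonneg j) (hdiag_le j))

theorem isCompact_setOf_isQuantumState : IsCompact {ρ : Matrix n n ℂ | IsQuantumState ρ} := by
  have hcube : IsCompact (Set.univ.pi fun _ : n => Set.univ.pi fun _ : n =>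
      Metric.closedBall (0 : ℂ) 1) :=
    isCompact_univ_pi fun _ => isCompact_univ_pi fun _ => isCompact_closedBall _ _
  have hclosed : IsClosed {ρ : Matrix n n ℂ | IsQuantumState ρ} := by
    have htrace : IsClosed {ρ : Matrix n n ℂ | ρ.trace = 1} :=
      isClosed_eq (by fun_prop) continuous_const
    convert isClosed_setOf_posSemidef.inter htrace using 1
    exact Set.ext fun ρ => ⟨fun h => ⟨h.1, h.2⟩, fun h => ⟨h.1, h.2⟩⟩
  refine hcube.of_isClosed_subset hclosed fun ρ hρ i _ j _ => ?_
  exact mem_closedBall_zero_iff.2 (IsQuantumState.norm_apply_le_one hρ i j)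

end QuantumState

section POVM

/-- A positive operator-valued measure with outcomes in `ι`: positive semidefinite effects that
sum to the identity. These are the most general quantum measurements; the additivity of linear
uncertainty relations is proved for them. -/
structure IsPOVM {ι n : Type*} [Fintype ι] [DecidableEq n] (X : ι → Matrix n n ℂ) : Prop where
  posSemidef : ∀ i, (X i).PosSemidef
  sum_eq_one : ∑ i, X i = 1

variable {ι κ n m : Type*} {X : ι → Matrix n n ℂ} {Z : κ → Matrix m m ℂ}

theorem IsProjectiveMeasurement.isPOVM [Fintype ι] [Fintype n] [DecidableEq n]
    (hX : IsProjectiveMeasurement X) : IsPOVM X where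
  posSemidef i := by
    have h := Matrix.posSemidef_conjTranspose_mul_self (X i)
    rwa [(hX.isHermitian i).eq, hX.mul_self i] at h
  sum_eq_one := hX.sum_eq_one

theorem IsPOVM.productMeasurement [Fintype ι] [Fintype κ] [Finite n] [DecidableEq n] [Finite m]
    [DecidableEq m] (hX : IsPOVM X) (hZ : IsPOVM Z) : IsPOVM (productMeasurement X Z) where
  posSemidef k := (hX.posSemidef k.1).kronecker (hZ.posSemidef k.2)
  sum_eq_one := by
    simp only [_root_.productMeasurement, Fintype.sum_prod_type, ← kronecker_sum, ← sum_kronecker,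
      hX.sum_eq_one, hZ.sum_eq_one, Matrix.one_kronecker_one]

variable [Fintype n] [Fintype m]

theorem outcomeProb_nonneg {ρ : Matrix n n ℂ} {i : ι} (hX : (X i).PosSemidef)
    (hρ : ρ.PosSemidef) : 0 ≤ outcomeProb X ρ i :=
  (Complex.le_def.1 (trace_mul_nonneg_of_posSemidef hρ hX)).1

theorem sum_outcomeProb [Fintype ι] [DecidableEq n] (hX : ∑ i, X i = 1) (ρ : Matrix n n ℂ) :
    ∑ i, outcomeProb X ρ i = ρ.trace.re := by
  simp only [outcomeProb]
  rw [← Complex.re_sum, ← Matrix.trace_sum, ← Finset.mul_sum, hX, mul_one]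

theorem sum_fst_outcomeProb_productMeasurement [Fintype ι] [DecidableEq n]
    (hX : ∑ i, X i = 1) (ρ : Matrix (n × m) (n × m) ℂ) (j : κ) :
    ∑ i, outcomeProb (productMeasurement X Z) ρ (i, j) =
      outcomeProb (fun j => (1 : Matrix n n ℂ) ⊗ₖ Z j) ρ j := by
  simp only [outcomeProb, productMeasurement]
  rw [← Complex.re_sum, ← Matrix.trace_sum, ← Finset.mul_sum, ← sum_kronecker, hX]

theorem sum_snd_outcomeProb_productMeasurement [Fintype κ] [DecidableEq m]
    (hZ : ∑ j, Z j = 1) (ρ : Matrix (n × m) (n × m) ℂ) (i : ι) :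
    ∑ j, outcomeProb (productMeasurement X Z) ρ (i, j) =
      outcomeProb (fun i => X i ⊗ₖ (1 : Matrix m m ℂ)) ρ i := by
  simp only [outcomeProb, productMeasurement]
  rw [← Complex.re_sum, ← Matrix.trace_sum, ← Finset.mul_sum, ← kronecker_sum, hZ]

theorem outcomeProb_productMeasurement_kronecker {ρ : Matrix n n ℂ} {i : ι}
    (hX : (X i).PosSemidef) (hρ : ρ.PosSemidef) (σ : Matrix m m ℂ) (j : κ) :
    outcomeProb (productMeasurement X Z) (ρ ⊗ₖ σ) (i, j) =
      outcomeProb X ρ i * outcomeProb Z σ j := by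
  have him : (ρ * X i).trace.im = 0 :=
    (Complex.le_def.1 (trace_mul_nonneg_of_posSemidef hρ hX)).2.symm
  rw [outcomeProb, productMeasurement, ← Matrix.mul_kronecker_mul, Matrix.trace_kronecker,
    Complex.mul_re, him, zero_mul, sub_zero, outcomeProb, outcomeProb]

variable [Fintype ι]

theorem continuous_measurementEntropy (X : ι → Matrix n n ℂ) :
    Continuous (measurementEntropy X) := by
  unfold measurementEntropy outcomeProb
  fun_prop

theorem measurementEntropy_smul [DecidableEq n] (hX : ∑ i, X i = 1) (t : ℝ) (ρ : Matrix n n ℂ) :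
    measurementEntropy X ((t : ℂ) • ρ) =
      ρ.trace.re * Real.negMulLog t + t * measurementEntropy X ρ := by
  have hsmul (i) : outcomeProb X ((t : ℂ) • ρ) i = t * outcomeProb X ρ i := by
    simp [outcomeProb]
  simp only [measurementEntropy, hsmul, Real.negMulLog_mul]
  rw [Finset.sum_add_distrib, ← Finset.sum_mul, ← Finset.mul_sum, sum_outcomeProb hX]

variable [Fintype κ] [DecidableEq n] [DecidableEq m]

theorem measurementEntropy_productMeasurement_le (hX : IsPOVM X) (hZ : IsPOVM Z)
    {ρ : Matrix (n × m) (n × m) ℂ} (hρ : IsQuantumState ρ) :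
    measurementEntropy (productMeasurement X Z) ρ ≤
      measurementEntropy (fun i => X i ⊗ₖ (1 : Matrix m m ℂ)) ρ +
        measurementEntropy (fun j => (1 : Matrix n n ℂ) ⊗ₖ Z j) ρ := by
  have hXZ := hX.productMeasurement hZ
  have hnonneg (k) : 0 ≤ outcomeProb (productMeasurement X Z) ρ k :=
    outcomeProb_nonneg (hXZ.posSemidef k) hρ.posSemidef
  have hsum : ∑ k, outcomeProb (productMeasurement X Z) ρ k = 1 := by
    rw [sum_outcomeProb hXZ.sum_eq_one, hρ.trace_eq_one, Complex.one_re]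
  have h := sum_negMulLog_le_sum_marginals hnonneg hsum.le
  simpa only [measurementEntropy, sum_fst_outcomeProb_productMeasurement hX.sum_eq_one,
    sum_snd_outcomeProb_productMeasurement hZ.sum_eq_one] using h

theorem measurementEntropy_productMeasurement_kronecker (hX : IsPOVM X) (hZ : IsPOVM Z)
    {ρ : Matrix n n ℂ} {σ : Matrix m m ℂ} (hρ : IsQuantumState ρ) (hσ : IsQuantumState σ) :
    measurementEntropy (productMeasurement X Z) (ρ ⊗ₖ σ) =
      measurementEntropy X ρ + measurementEntropy Z σ := by
  simp only [measurementEntropy, Fintype.sum_prod_type,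
    outcomeProb_productMeasurement_kronecker (hX.posSemidef _) hρ.posSemidef,
    Real.negMulLog_mul, Finset.sum_add_distrib, ← Finset.sum_mul, ← Finset.mul_sum,
    sum_outcomeProb hX.sum_eq_one, sum_outcomeProb hZ.sum_eq_one, hρ.trace_eq_one,
    hσ.trace_eq_one, Complex.one_re, one_mul]

end POVM

section ConditionalEntropy

variable {ι κ n m : Type*} [Fintype m] {X : ι → Matrix n n ℂ} {Z : κ → Matrix m m ℂ}

/-- The unnormalized conditional state `tr₂ (ρ (1 ⊗ E))` of the first subsystem, given that the
effect `E` was observed on the second one. Its trace is the probability of that observation. -/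
def conditionalState (E : Matrix m m ℂ) (ρ : Matrix (n × m) (n × m) ℂ) : Matrix n n ℂ :=
  Matrix.of fun i j => ∑ k, ∑ l, ρ (i, k) (j, l) * E l k

theorem trace_conditionalState_mul [Fintype n] (E : Matrix m m ℂ) (ρ : Matrix (n × m) (n × m) ℂ)
    (M : Matrix n n ℂ) : (conditionalState E ρ * M).trace = (ρ * M ⊗ₖ E).trace := by
  simp only [conditionalState, Matrix.trace, Matrix.diag, Matrix.mul_apply, Matrix.of_apply,
    Fintype.sum_prod_type, Matrix.kronecker_apply, Finset.sum_mul]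
  refine Finset.sum_congr rfl fun i _ => ?_
  rw [Finset.sum_comm]
  exact Finset.sum_congr rfl fun k _ => Finset.sum_congr rfl fun j _ =>
    Finset.sum_congr rfl fun l _ => by ring

theorem outcomeProb_conditionalState [Fintype n] (ρ : Matrix (n × m) (n × m) ℂ) (i : ι) (j : κ) :
    outcomeProb X (conditionalState (Z j) ρ) i =
      outcomeProb (productMeasurement X Z) ρ (i, j) :=
  congrArg Complex.re (trace_conditionalState_mul (Z j) ρ (X i))

theorem trace_conditionalState_re [Fintype n] [DecidableEq n] (ρ : Matrix (n × m) (n × m) ℂ)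
    (j : κ) :
    (conditionalState (Z j) ρ).trace.re =
      outcomeProb (fun j => (1 : Matrix n n ℂ) ⊗ₖ Z j) ρ j := by
  rw [outcomeProb, ← trace_conditionalState_mul, mul_one]

theorem posSemidef_conditionalState [Finite n] {E : Matrix m m ℂ} {ρ : Matrix (n × m) (n × m) ℂ}
    (hE : E.PosSemidef) (hρ : ρ.PosSemidef) : (conditionalState E ρ).PosSemidef := by
  have := Fintype.ofFinite n
  refine .of_dotProduct_mulVec_nonneg ?_ fun x => ?_
  · refine Matrix.IsHermitian.ext fun i j => ?_
    simp only [conditionalState, Matrix.of_apply, star_sum, star_mul', hρ.isHermitian.apply,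
      hE.isHermitian.apply]
    exact Finset.sum_comm
  · have h := trace_mul_nonneg_of_posSemidef hρ
      ((Matrix.posSemidef_vecMulVec_self_star x).kronecker hE)
    rwa [← trace_conditionalState_mul, Matrix.mul_vecMulVec, Matrix.trace_vecMulVec,
      dotProduct_comm] at h

variable [Fintype ι] [Fintype κ] [Fintype n]

/-- The entropy `H(X|Z) = H(XZ) - H(Z)` of the outcome of `X` on the first subsystem, conditioned
on the outcome of `Z` on the second one. The chain rule serves as the definition. -/
noncomputable def conditionalEntropy [DecidableEq n] (X : ι → Matrix n n ℂ)
    (Z : κ → Matrix m m ℂ) (ρ : Matrix (n × m) (n × m) ℂ) : ℝ :=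
  measurementEntropy (productMeasurement X Z) ρ -
    measurementEntropy (fun j => (1 : Matrix n n ℂ) ⊗ₖ Z j) ρ

theorem sum_measurementEntropy_conditionalState_sub [DecidableEq n]
    (ρ : Matrix (n × m) (n × m) ℂ) :
    ∑ j, (measurementEntropy X (conditionalState (Z j) ρ) -
      Real.negMulLog (conditionalState (Z j) ρ).trace.re) = conditionalEntropy X Z ρ := by
  rw [Finset.sum_sub_distrib]
  simp only [measurementEntropy, outcomeProb_conditionalState, trace_conditionalState_re,
    conditionalEntropy, Fintype.sum_prod_type_right]

theorem conditionalEntropy_submatrix_prodComm [DecidableEq m] (ρ : Matrix (n × m) (n × m) ℂ) :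
    conditionalEntropy Z X
        (ρ.submatrix (Equiv.prodComm m n) (Equiv.prodComm m n)) =
      measurementEntropy (productMeasurement X Z) ρ -
        measurementEntropy (fun i => X i ⊗ₖ (1 : Matrix m m ℂ)) ρ := by
  simp only [conditionalEntropy, measurementEntropy, outcomeProb, productMeasurement,
    trace_submatrix_prodComm_mul_kronecker]
  rw [Fintype.sum_prod_type_right, Fintype.sum_prod_type]

end ConditionalEntropy

section UncertaintyBound

variable {ι κ n : Type*} [Fintype ι] [Fintype κ] [Fintype n] {lam mu c : ℝ}
  {X : ι → Matrix n n ℂ} {Y : κ → Matrix n n ℂ}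

/-- This is the defining inequality at `R / tr R`, multiplied by `tr R`: the correction
`negMulLog (tr R)` is the failure of the entropy to be homogeneous. -/
theorem IsUncertaintyBound.trace_mul_le [DecidableEq n] (hc : IsUncertaintyBound lam mu X Y c)
    (hX : ∑ i, X i = 1) (hY : ∑ k, Y k = 1) {R : Matrix n n ℂ} (hR : R.PosSemidef) :
    R.trace.re * c ≤ lam * (measurementEntropy X R - Real.negMulLog R.trace.re) +
      mu * (measurementEntropy Y R - Real.negMulLog R.trace.re) := by
  obtain ⟨t, ht⟩ : ∃ t : ℝ, R.trace = t :=
    ⟨R.trace.re, Complex.ext rfl (Complex.le_def.1 hR.trace_nonneg).2.symm⟩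
  have ht_nonneg : 0 ≤ t := by simpa [ht] using hR.trace_nonneg
  rcases ht_nonneg.eq_or_lt with rfl | ht_pos
  · have hR_zero : R = 0 := hR.trace_eq_zero_iff.1 (by rw [ht, Complex.ofReal_zero])
    simp [hR_zero, measurementEntropy, outcomeProb]
  have htC : (t : ℂ) ≠ 0 := Complex.ofReal_ne_zero.2 ht_pos.ne'
  obtain ⟨ρ, hρ, hRρ⟩ : ∃ ρ, IsQuantumState ρ ∧ R = (t : ℂ) • ρ :=
    ⟨((t⁻¹ : ℝ) : ℂ) • R,
      ⟨hR.smul (by simpa using ht_nonneg), by simp [Matrix.trace_smul, ht, htC]⟩,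
      by simp [smul_smul, htC]⟩
  have hbound : t * c ≤ t * linearUncertainty lam mu X Y ρ :=
    mul_le_mul_of_nonneg_left (hc ρ hρ) ht_nonneg
  have hentropy_X := measurementEntropy_smul hX t ρ
  have hentropy_Y := measurementEntropy_smul hY t ρ
  rw [← hRρ, hρ.trace_eq_one, Complex.one_re] at hentropy_X hentropy_Y
  rw [ht, Complex.ofReal_re, hentropy_X, hentropy_Y]
  rw [linearUncertainty] at hbound
  linarith

theorem IsUncertaintyBound.le_conditionalEntropy {ν m : Type*} [Fintype ν] [DecidableEq n]
    [Fintype m] [DecidableEq m] {Z : ν → Matrix m m ℂ} (hc : IsUncertaintyBound lam mu X Y c)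
    (hX : IsPOVM X) (hY : IsPOVM Y) (hZ : IsPOVM Z) {ρ : Matrix (n × m) (n × m) ℂ}
    (hρ : IsQuantumState ρ) :
    c ≤ lam * conditionalEntropy X Z ρ + mu * conditionalEntropy Y Z ρ := by
  have htrace : ∑ j, (conditionalState (Z j) ρ).trace.re = 1 := by
    have hsum : ∑ j, (1 : Matrix n n ℂ) ⊗ₖ Z j = 1 := by
      rw [← kronecker_sum, hZ.sum_eq_one, Matrix.one_kronecker_one]
    simp only [trace_conditionalState_re, sum_outcomeProb hsum, hρ.trace_eq_one, Complex.one_re]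
  calc c = ∑ j, (conditionalState (Z j) ρ).trace.re * c := by
        rw [← Finset.sum_mul, htrace, one_mul]
    _ ≤ ∑ j, (lam * (measurementEntropy X (conditionalState (Z j) ρ) -
            Real.negMulLog (conditionalState (Z j) ρ).trace.re) +
          mu * (measurementEntropy Y (conditionalState (Z j) ρ) -
            Real.negMulLog (conditionalState (Z j) ρ).trace.re)) :=
        Finset.sum_le_sum fun j _ =>
          hc.trace_mul_le hX.sum_eq_one hY.sum_eq_one
            (posSemidef_conditionalState (hZ.posSemidef j) hρ.posSemidef)
    _ = lam * conditionalEntropy X Z ρ + mu * conditionalEntropy Y Z ρ := by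
        rw [Finset.sum_add_distrib, ← Finset.mul_sum, ← Finset.mul_sum,
          sum_measurementEntropy_conditionalState_sub, sum_measurementEntropy_conditionalState_sub]

theorem IsOptimalUncertaintyBound.exists_linearUncertainty_eq
    (hc : IsOptimalUncertaintyBound lam mu X Y c) :
    ∃ ρ, IsQuantumState ρ ∧ linearUncertainty lam mu X Y ρ = c := by
  have hne : {ρ : Matrix n n ℂ | IsQuantumState ρ}.Nonempty := by
    by_contra h
    have hbound : IsUncertaintyBound lam mu X Y (c + 1) := fun ρ hρ => (h ⟨ρ, hρ⟩).elim
    linarith [hc.2 hbound]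
  have hcont : Continuous (linearUncertainty lam mu X Y) :=
    ((continuous_measurementEntropy X).const_mul lam).add
      ((continuous_measurementEntropy Y).const_mul mu)
  obtain ⟨ρ, hρ, hmin⟩ := isCompact_setOf_isQuantumState.exists_isMinOn hne hcont.continuousOn
  exact ⟨ρ, hρ, le_antisymm (hc.2 fun σ hσ => hmin hσ) (hc.1 ρ hρ)⟩

end UncertaintyBound

section Additivity

variable {a b ιA κA ιB κB : Type*} [Fintype a] [DecidableEq a] [Fintype b] [DecidableEq b]
  [Fintype ιA] [Fintype κA] [Fintype ιB] [Fintype κB]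
  {XA : ιA → Matrix a a ℂ} {YA : κA → Matrix a a ℂ}
  {XB : ιB → Matrix b b ℂ} {YB : κB → Matrix b b ℂ}

theorem linearUncertainty_productMeasurement_kronecker (hXA : IsPOVM XA) (hYA : IsPOVM YA)
    (hXB : IsPOVM XB) (hYB : IsPOVM YB) (lam mu : ℝ) {ρA : Matrix a a ℂ} {ρB : Matrix b b ℂ}
    (hρA : IsQuantumState ρA) (hρB : IsQuantumState ρB) :
    linearUncertainty lam mu (productMeasurement XA XB) (productMeasurement YA YB) (ρA ⊗ₖ ρB) =
      linearUncertainty lam mu XA YA ρA + linearUncertainty lam mu XB YB ρB := by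
  simp only [linearUncertainty, measurementEntropy_productMeasurement_kronecker hXA hXB hρA hρB,
    measurementEntropy_productMeasurement_kronecker hYA hYB hρA hρB]
  ring

theorem IsUncertaintyBound.add_productMeasurement (hXA : IsPOVM XA) (hYA : IsPOVM YA)
    (hXB : IsPOVM XB) (hYB : IsPOVM YB) {lam mu cA cB : ℝ} (hweight : 0 ≤ lam + mu)
    (hA : IsUncertaintyBound lam mu XA YA cA) (hB : IsUncertaintyBound lam mu XB YB cB) :
    IsUncertaintyBound lam mu (productMeasurement XA XB) (productMeasurement YA YB)
      (cA + cB) := by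
  intro ρ hρ
  have hcond_A := hA.le_conditionalEntropy hXA hYA hXB hρ
  have hcond_B := hB.le_conditionalEntropy hXB hYB hYA
    (hρ.submatrix_equiv (Equiv.prodComm b a))
  have hsubadd := mul_le_mul_of_nonneg_left
    (measurementEntropy_productMeasurement_le hYA hXB hρ) hweight
  rw [conditionalEntropy, conditionalEntropy] at hcond_A
  rw [conditionalEntropy_submatrix_prodComm, conditionalEntropy_submatrix_prodComm] at hcond_B
  rw [linearUncertainty]
  linarith

theorem proposition1_general (hXA : IsPOVM XA) (hYA : IsPOVM YA) (hXB : IsPOVM XB)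
    (hYB : IsPOVM YB) {lam mu : ℝ} (hweight : 0 ≤ lam + mu) (cA cB : ℝ) :
    (IsUncertaintyBound lam mu XA YA cA → IsUncertaintyBound lam mu XB YB cB →
      IsUncertaintyBound lam mu (productMeasurement XA XB) (productMeasurement YA YB)
        (cA + cB)) ∧
    (IsOptimalUncertaintyBound lam mu XA YA cA → IsOptimalUncertaintyBound lam mu XB YB cB →
      IsOptimalUncertaintyBound lam mu (productMeasurement XA XB) (productMeasurement YA YB)
        (cA + cB) ∧
      ∃ (ρA : Matrix a a ℂ) (ρB : Matrix b b ℂ), IsQuantumState ρA ∧ IsQuantumState ρB ∧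
        linearUncertainty lam mu (productMeasurement XA XB) (productMeasurement YA YB)
          (ρA ⊗ₖ ρB) = cA + cB) := by
  have hadd := IsUncertaintyBound.add_productMeasurement hXA hYA hXB hYB hweight
    (cA := cA) (cB := cB)
  refine ⟨hadd, fun hA hB => ?_⟩
  obtain ⟨ρA, hρA, hcA⟩ := hA.exists_linearUncertainty_eq
  obtain ⟨ρB, hρB, hcB⟩ := hB.exists_linearUncertainty_eq
  have hattained : linearUncertainty lam mu (productMeasurement XA XB) (productMeasurement YA YB)
      (ρA ⊗ₖ ρB) = cA + cB := by
    rw [linearUncertainty_productMeasurement_kronecker hXA hYA hXB hYB lam mu hρA hρB, hcA, hcB]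
  exact ⟨⟨hadd hA.1 hB.1, fun c hc => hattained ▸ hc _ (hρA.kronecker hρB)⟩,
    ρA, ρB, hρA, hρB, hattained⟩

end Additivity

theorem proposition1 {a b ιA κA ιB κB : Type*}
    [Fintype a] [DecidableEq a] [Fintype b] [DecidableEq b]
    [Fintype ιA] [Fintype κA] [Fintype ιB] [Fintype κB]
    (XA : ιA → Matrix a a ℂ) (YA : κA → Matrix a a ℂ)
    (XB : ιB → Matrix b b ℂ) (YB : κB → Matrix b b ℂ)
    (hXA : IsProjectiveMeasurement XA) (hYA : IsProjectiveMeasurement YA)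
    (hXB : IsProjectiveMeasurement XB) (hYB : IsProjectiveMeasurement YB)
    (lam mu : ℝ) (hlam : 0 ≤ lam) (hmu : 0 ≤ mu) (cA cB : ℝ) :
    (IsUncertaintyBound lam mu XA YA cA → IsUncertaintyBound lam mu XB YB cB →
      IsUncertaintyBound lam mu (productMeasurement XA XB) (productMeasurement YA YB)
        (cA + cB)) ∧
    (IsOptimalUncertaintyBound lam mu XA YA cA → IsOptimalUncertaintyBound lam mu XB YB cB →
      IsOptimalUncertaintyBound lam mu (productMeasurement XA XB) (productMeasurement YA YB)
        (cA + cB) ∧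
      ∃ (ρA : Matrix a a ℂ) (ρB : Matrix b b ℂ), IsQuantumState ρA ∧ IsQuantumState ρB ∧
        linearUncertainty lam mu (productMeasurement XA XB) (productMeasurement YA YB)
          (ρA ⊗ₖ ρB) = cA + cB) :=
  proposition1_general hXA.isPOVM hYA.isPOVM hXB.isPOVM hYB.isPOVM (add_nonneg hlam hmu) cA cB
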